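/- For a continuous function $f:\mathbb R\to\mathbb R$, $x\in\mathbb R$ and $r>0$ put $$M_f(x,r)=\sup\Big\{\frac{|f(x)-f(y)|}{r} : |x-y|\le r\Big\},\qquad \operatorname{Lip} f(x)=\limsup_{r\to 0^+}M_f(x,r),\qquad \operatorname{lip} f(x)=\liminf_{r\to 0^+}M_f(x,r),$$ and let $L_f^\infty=\{x\in\mathbb R:\operatorname{Lip} f(x)=\infty\}$ and $l_f^\infty=\{x\in\mathbb R:\operatorname{lip} f(x)=\infty\}$. Call a set $E\subset\mathbb R$ trim if $|E\cap(a,b)|<b-a$ for all real numbers $a<b$, where $|\cdot|$ denotes Lebesgue measure. Theorem. Suppose that $f:\mathbb R\to\mathbb R$ is continuous and $l_f^\infty=\emptyset$. Then $L_f^\infty$ is a trim $G_\delta$ set. Conversely, if $E\subset\mathbb R$ is a trim $G_\delta$ set, then there exists a continuous function $f:\mathbb R\to\mathbb R$ such that $L_f^\infty=E$ and $l_f^\infty=\emptyset$. Moreover, $f$ may be constructed so that, in addition, $\operatorname{lip} f(x)=0$ for all $x\in E$. -/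

import Mathlib

open Set Filter Topology MeasureTheory
open scoped ENNReal

/-- `M_f(x, r) = sup { |f x - f y| / r : |x - y| ≤ r }`, with values in `[0, ∞]`
(only used for `r > 0`). -/
noncomputable def oscQuot (f : ℝ → ℝ) (x r : ℝ) : ℝ≥0∞ :=
  ⨆ (y : ℝ) (_ : |x - y| ≤ r), ENNReal.ofReal (|f x - f y| / r)

/-- The "big Lip" function `Lip f`, with values in `[0, ∞]`. -/
noncomputable def bigLip (f : ℝ → ℝ) (x : ℝ) : ℝ≥0∞ :=
  limsup (fun r : ℝ => oscQuot f x r) (𝓝[>] 0)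

/-- The "little lip" function `lip f`, with values in `[0, ∞]`. -/
noncomputable def littleLip (f : ℝ → ℝ) (x : ℝ) : ℝ≥0∞ :=
  liminf (fun r : ℝ => oscQuot f x r) (𝓝[>] 0)

/-- The set of points where `Lip f` is infinite. -/
def bigLipInfSet (f : ℝ → ℝ) : Set ℝ := {x | bigLip f x = ∞}

/-- The set of points where `lip f` is infinite. -/
def littleLipInfSet (f : ℝ → ℝ) : Set ℝ := {x | littleLip f x = ∞}

/-- `E ⊆ ℝ` is trim if `|E ∩ (a, b)| < b - a` for all (nonempty, bounded) open intervals
`(a, b)`, where `|·|` is Lebesgue measure. -/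
def IsTrim (E : Set ℝ) : Prop :=
  ∀ a b : ℝ, a < b → volume (E ∩ Ioo a b) < ENNReal.ofReal (b - a)

/-! ### Elementary descriptions of `bigLip` and `littleLip` -/

/-! Necessity. Suppose `lip f` is finite everywhere but `Lip f = ∞` almost everywhere on an
interval. Near each such point some short chord has slope of size at least 4K. Tilting `f` by slope
2K leaves a function that maps null sets to null sets, so some level avoids the image of the
exceptional set; the last point of the chord at that level lies in `L_f^∞` and sees oscillation at
least K·r at every radius up to the chord's length (`exists_steepAt_of_slope`). Iterating with K → ∞
and rapidly shrinking chords gives a limit point where `lip f = ∞`, a contradiction.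

Sufficiency. Trimness puts compact sets of positive measure off `E` in every interval, hence bumps
that vary only on such sets (`exists_bump`). Bumps on the Whitney cells of an open `U ⊇ E` give a
function that is steep from every point of `U`, dominated by the distance to the complement of `U`,
and locally constant on a smaller open `V ⊇ E` (`exists_stage`). Iterate along open sets shrinking
to `E` and sum. At a point of `E`, a suitable scale isolates stage N: earlier stages are constant
and later ones negligible, so slopes of order N occur. At half the distance to the complement of the
next open set, stage N is constant too, so `lip` vanishes. Off `E`, only finitely many stages are
not controlled by the distance bound, and these are locally Lipschitz. -/

theorem le_oscQuot {f : ℝ → ℝ} {x y r K : ℝ} (hr : 0 < r) (hy : |x - y| ≤ r)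
    (h : K * r ≤ |f x - f y|) : ENNReal.ofReal K ≤ oscQuot f x r :=
  le_iSup₂_of_le (f := fun y (_ : |x - y| ≤ r) => ENNReal.ofReal (|f x - f y| / r)) y hy
    (ENNReal.ofReal_le_ofReal ((le_div_iff₀ hr).2 h))

theorem oscQuot_le {f : ℝ → ℝ} {x r K : ℝ} (hr : 0 < r)
    (h : ∀ y, |x - y| ≤ r → |f x - f y| ≤ K * r) : oscQuot f x r ≤ ENNReal.ofReal K :=
  iSup₂_le fun y hy => ENNReal.ofReal_le_ofReal ((div_le_iff₀ hr).2 (h y hy))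

theorem abs_sub_le_of_oscQuot_le {f : ℝ → ℝ} {x y r K : ℝ} (hK : 0 ≤ K) (hr : 0 < r)
    (h : oscQuot f x r ≤ ENNReal.ofReal K) (hy : |x - y| ≤ r) : |f x - f y| ≤ K * r := by
  have h1 : ENNReal.ofReal (|f x - f y| / r) ≤ ENNReal.ofReal K :=
    (le_iSup₂ (f := fun y (_ : |x - y| ≤ r) => ENNReal.ofReal (|f x - f y| / r)) y hy).trans h
  exact (div_le_iff₀ hr).1 ((ENNReal.ofReal_le_ofReal_iff hK).1 h1)

/-- Shrinking r to |x - y| only enlarges the quotient, so the radius can be eliminated. The strict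
inequalities make the condition open in `x`, which yields the Gδ property. -/
theorem bigLip_eq_top_iff {f : ℝ → ℝ} {x : ℝ} :
    bigLip f x = ∞ ↔ ∀ n : ℕ, ∃ y, 0 < |x - y| ∧ |x - y| < 1 / ((n : ℝ) + 1) ∧
      n * |x - y| < |f x - f y| := by
  constructor
  · intro h n
    have h1 : ENNReal.ofReal n < limsup (fun r : ℝ => oscQuot f x r) (𝓝[>] 0) := by
      rw [show limsup (fun r : ℝ => oscQuot f x r) (𝓝[>] 0) = ∞ from h]
      exact ENNReal.ofReal_lt_top
    have h2 := frequently_lt_of_lt_limsup (by isBoundedDefault) h1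
    have h3 : ∀ᶠ r : ℝ in 𝓝[>] 0, r ∈ Ioo 0 (1 / ((n : ℝ) + 1)) :=
      Ioo_mem_nhdsGT (by positivity)
    obtain ⟨r, hr, hr0, hr1⟩ := (h2.and_eventually h3).exists
    obtain ⟨y, hy⟩ := lt_iSup_iff.1 hr
    obtain ⟨hy1, hy2⟩ := lt_iSup_iff.1 hy
    have h4 : (n : ℝ) < |f x - f y| / r := by
      by_contra hc
      exact absurd hy2 (not_lt.2 (ENNReal.ofReal_le_ofReal (not_lt.1 hc)))
    rw [lt_div_iff₀ hr0] at h4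
    refine ⟨y, ?_, hy1.trans_lt hr1, lt_of_le_of_lt ?_ h4⟩
    · rw [abs_pos, sub_ne_zero]
      rintro rfl
      simp only [sub_self, abs_zero] at h4
      exact absurd h4 (not_lt.2 (by positivity))
    · gcongr
  · intro h
    refine ENNReal.eq_top_of_forall_nnreal_le fun K => ?_
    refine le_limsup_of_frequently_le ?_ (by isBoundedDefault)
    rw [frequently_iff]
    intro U hU
    obtain ⟨δ, hδ, hU⟩ := mem_nhdsGT_iff_exists_Ioo_subset.1 hU
    obtain ⟨n, hn⟩ := exists_nat_gt (max (K : ℝ) (1 / δ))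
    obtain ⟨y, hy0, hy1, hy2⟩ := h n
    have hδ : (0 : ℝ) < δ := hδ
    have hnK := (le_max_left _ _).trans_lt hn
    have hnd := (le_max_right _ _).trans_lt hn
    refine ⟨|x - y|, hU ⟨hy0, hy1.trans ?_⟩, ?_⟩
    · rw [div_lt_iff₀ (by positivity)]
      rw [div_lt_iff₀ hδ] at hnd
      nlinarith
    · rw [← ENNReal.ofReal_coe_nnreal]
      refine le_oscQuot hy0 le_rfl (le_trans ?_ hy2.le)
      gcongr

theorem bigLip_ne_top_of_eventually {f : ℝ → ℝ} {x Λ : ℝ}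
    (h : ∀ᶠ y in 𝓝 x, |f y - f x| ≤ Λ * |y - x|) : bigLip f x ≠ ∞ := by
  rw [Ne, bigLip_eq_top_iff]
  intro hx
  obtain ⟨δ, hδ, h⟩ := Metric.eventually_nhds_iff.1 h
  obtain ⟨n, hn⟩ := exists_nat_gt (max Λ (1 / δ))
  have hnK := (le_max_left _ _).trans_lt hn
  have hnd := (le_max_right _ _).trans_lt hn
  obtain ⟨y, hy0, hy1, hy2⟩ := hx n
  have hlt : 1 / ((n : ℝ) + 1) < δ := by
    rw [div_lt_iff₀ (by positivity)]
    rw [div_lt_iff₀ hδ] at hnd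
    nlinarith
  have := h (y := y) (by rw [Real.dist_eq, abs_sub_comm]; linarith)
  rw [abs_sub_comm (f y), abs_sub_comm y] at this
  nlinarith

theorem littleLip_le_bigLip (f : ℝ → ℝ) (x : ℝ) : littleLip f x ≤ bigLip f x :=
  liminf_le_limsup

theorem littleLip_eq_top_of_eventually {f : ℝ → ℝ} {x : ℝ}
    (h : ∀ k : ℕ, ∀ᶠ r : ℝ in 𝓝[>] 0, ∃ y, |x - y| ≤ r ∧ k * r ≤ |f x - f y|) :
    littleLip f x = ∞ := by
  refine ENNReal.eq_top_of_forall_nnreal_le fun K => ?_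
  obtain ⟨k, hk⟩ := exists_nat_gt (K : ℝ)
  refine le_liminf_of_le (by isBoundedDefault) ?_
  filter_upwards [h k, self_mem_nhdsWithin] with r hr hr0
  obtain ⟨y, hy, hy1⟩ := hr
  have hr0 : (0 : ℝ) < r := hr0
  rw [← ENNReal.ofReal_coe_nnreal]
  refine le_oscQuot hr0 hy (le_trans ?_ hy1)
  gcongr

theorem exists_frequently_of_littleLip_ne_top {f : ℝ → ℝ} {x : ℝ} (h : littleLip f x ≠ ∞) :
    ∃ M : ℝ, ∃ᶠ r : ℝ in 𝓝[>] 0, ∀ y, |x - y| ≤ r → |f x - f y| ≤ M * r := by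
  obtain ⟨M, hM⟩ := ENNReal.lt_iff_exists_nnreal_btwn.1 (lt_top_iff_ne_top.2 h)
  refine ⟨M, ?_⟩
  have h1 := frequently_lt_of_liminf_lt (by isBoundedDefault) hM.1
  refine (h1.and_eventually self_mem_nhdsWithin).mono ?_
  rintro r ⟨hr, hr0⟩ y hy
  rw [← ENNReal.ofReal_coe_nnreal] at hr
  exact abs_sub_le_of_oscQuot_le M.2 hr0 hr.le hy

theorem littleLip_eq_zero_of_frequently {f : ℝ → ℝ} {x : ℝ}
    (h : ∀ ε : ℝ, 0 < ε → ∃ᶠ r : ℝ in 𝓝[>] 0, ∀ y, |x - y| ≤ r → |f x - f y| ≤ ε * r) :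
    littleLip f x = 0 := by
  refine nonpos_iff_eq_zero.1 (ENNReal.le_of_forall_pos_le_add fun ε hε _ => ?_)
  rw [zero_add]
  refine liminf_le_of_frequently_le ?_ (by isBoundedDefault)
  refine ((h ε hε).and_eventually self_mem_nhdsWithin).mono ?_
  rintro r ⟨hr, hr0⟩
  rw [← ENNReal.ofReal_coe_nnreal]
  exact oscQuot_le hr0 hr

/-! ### The set where `bigLip` is infinite, when `littleLip` is finite -/

theorem isGδ_bigLipInfSet {f : ℝ → ℝ} (hf : Continuous f) : IsGδ (bigLipInfSet f) := by
  have : bigLipInfSet f = ⋂ n : ℕ, ⋃ y : ℝ, {x | 0 < |x - y| ∧ |x - y| < 1 / ((n : ℝ) + 1) ∧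
      n * |x - y| < |f x - f y|} := by
    ext x
    simp only [bigLipInfSet, mem_ofPred_eq, bigLip_eq_top_iff, mem_iInter, mem_iUnion]
  rw [this]
  refine IsGδ.iInter_of_isOpen fun n => isOpen_iUnion fun y => ?_
  have h1 : Continuous fun x : ℝ => |x - y| := by fun_prop
  have h2 : Continuous fun x : ℝ => |f x - f y| := by fun_prop
  exact (isOpen_lt continuous_const h1).inter ((isOpen_lt h1 continuous_const).inter
    (isOpen_lt (continuous_const.mul h1) h2))

/-- Good radii merely accumulate at 0, which is exactly what the Besicovitch covering theorem needs:
cover by good balls of total length at most ε, each mapped into a ball at most n times as long. -/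
theorem volume_image_eq_zero_of_frequently {g : ℝ → ℝ} {Z : Set ℝ} (hZ : volume Z = 0)
    (h : ∀ x ∈ Z, ∃ M : ℝ, ∃ᶠ r : ℝ in 𝓝[>] 0, ∀ y, |x - y| ≤ r → |g x - g y| ≤ M * r) :
    volume (g '' Z) = 0 := by
  let W : ℕ → Set ℝ := fun n =>
    {x ∈ Z | ∃ᶠ r : ℝ in 𝓝[>] 0, ∀ y, |x - y| ≤ r → |g x - g y| ≤ n * r}
  have hZW : Z ⊆ ⋃ n, W n := by
    intro x hx
    obtain ⟨M, hM⟩ := h x hx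
    obtain ⟨n, hn⟩ := exists_nat_gt M
    refine mem_iUnion.2 ⟨n, hx, (hM.and_eventually self_mem_nhdsWithin).mono ?_⟩
    rintro r ⟨hr, hr0⟩ y hy
    have hr0 : (0 : ℝ) < r := hr0
    exact (hr y hy).trans (by gcongr)
  refine measure_mono_null (image_mono hZW) ?_
  rw [image_iUnion, measure_iUnion_null_iff]
  intro n
  have hW : volume (W n) = 0 := measure_mono_null (fun x hx => hx.1) hZ
  have key : ∀ ε : ℝ≥0∞, ε ≠ 0 → volume (g '' W n) ≤ n * ε := by
    intro ε hε
    obtain ⟨t, r, htc, -, hr, hcov, hsum⟩ :=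
      Besicovitch.exists_closedBall_covering_tsum_measure_le volume hε
        (fun x => {r : ℝ | ∀ y, |x - y| ≤ r → |g x - g y| ≤ n * r}) (W n) (by
          intro x hx δ hδ
          obtain ⟨r, hr1, hr2⟩ := (hx.2.and_eventually (Ioo_mem_nhdsGT hδ)).exists
          exact ⟨r, hr1, hr2⟩)
    rw [hW, zero_add] at hsum
    have : Countable t := htc.to_subtype
    calc volume (g '' W n) ≤ volume (⋃ x : t, Metric.closedBall (g x) (n * r x)) := by
          refine measure_mono ?_
          rintro _ ⟨z, hz, rfl⟩
          obtain ⟨x, hx, hzx⟩ := mem_iUnion₂.1 (hcov hz)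
          refine mem_iUnion.2 ⟨⟨x, hx⟩, ?_⟩
          rw [Metric.mem_closedBall, Real.dist_eq, abs_sub_comm] at hzx ⊢
          exact hr x hx z hzx
      _ ≤ ∑' x : t, volume (Metric.closedBall (g x) (n * r x)) := measure_iUnion_le _
      _ = ∑' x : t, n * volume (Metric.closedBall (x : ℝ) (r x)) := by
          congr 1 with x
          rw [Real.volume_closedBall, Real.volume_closedBall, ← ENNReal.ofReal_natCast,
            ← ENNReal.ofReal_mul (by positivity)]
          ring_nf
      _ = n * ∑' x : t, volume (Metric.closedBall (x : ℝ) (r x)) := ENNReal.tsum_mul_left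
      _ ≤ n * ε := by gcongr
  refine nonpos_iff_eq_zero.1 (ENNReal.le_of_forall_pos_le_add fun ε hε _ => ?_)
  rw [zero_add]
  rcases Nat.eq_zero_or_pos n with rfl | hn
  · exact (key 1 one_ne_zero).trans (by simp)
  · refine (key (ε / n) ?_).trans ?_
    · simp [hε.ne']
    · rw [ENNReal.mul_div_cancel (by simpa using hn.ne') (by simp)]

/-- The image under `g` of the set of last points at a given level contains all levels between
`g c` and `g d`. -/
theorem exists_last_point {g : ℝ → ℝ} (hg : Continuous g) {c d s : ℝ} (hcd : c ≤ d)
    (hs : s ∈ Ico (g c) (g d)) : ∃ x ∈ Icc c d, g x = s ∧ ∀ y ∈ Icc c d, x < y → s < g y := by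
  have hcomp : IsCompact (Icc c d ∩ {x | g x ≤ s}) :=
    isCompact_Icc.inter_right (isClosed_le hg continuous_const)
  obtain ⟨x, ⟨hx, hxs⟩, hmax⟩ := hcomp.exists_isGreatest ⟨c, left_mem_Icc.2 hcd, hs.1⟩
  have hlast : ∀ y ∈ Icc c d, x < y → s < g y := fun y hy hxy => by
    by_contra hc
    exact absurd (hmax ⟨hy, not_lt.1 hc⟩) (not_le.2 hxy)
  refine ⟨x, hx, ?_, hlast⟩
  refine le_antisymm hxs (not_lt.1 fun hlt => ?_)
  obtain ⟨y, hy, hys⟩ := intermediate_value_Icc hx.2 hg.continuousOn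
    (show s ∈ Icc (g x) (g d) from ⟨hlt.le, hs.2.le⟩)
  have hxy : x < y := lt_of_le_of_ne hy.1 (by rintro rfl; exact hlt.ne hys)
  exact absurd (hlast y ⟨hx.1.trans hy.1, hy.2⟩ hxy) (by rw [hys]; exact lt_irrefl s)

/-- `f` oscillates by at least `K * r` on the ball of radius `r` around `x`,
for all `r ∈ (0, ℓ]`. -/
def SteepAt (f : ℝ → ℝ) (K ℓ x : ℝ) : Prop :=
  ∀ r, 0 < r → r ≤ ℓ → ∃ y, |x - y| ≤ r ∧ K * r ≤ |f x - f y|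

theorem exists_steepAt_of_slope {f : ℝ → ℝ} (hf : Continuous f) {Z : Set ℝ} (hZ : volume Z = 0)
    (hl : ∀ x, littleLip f x ≠ ∞) {c d K : ℝ} (hcd : c < d) (hK : 0 < K)
    (hs : 4 * K * (d - c) ≤ f d - f c) : ∃ x ∈ Icc c d, x ∉ Z ∧ SteepAt f K (d - c) x := by
  set g : ℝ → ℝ := fun x => f x - 2 * K * x with hgdef
  have hg : Continuous g := by fun_prop
  have hgZ : volume (g '' Z) = 0 := by
    refine volume_image_eq_zero_of_frequently hZ fun x _ => ?_
    obtain ⟨M, hM⟩ := exists_frequently_of_littleLip_ne_top (hl x)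
    refine ⟨M + 2 * K, hM.mono fun r hr y hy => ?_⟩
    calc |g x - g y| = |(f x - f y) - 2 * K * (x - y)| := by simp only [hgdef]; ring_nf
      _ ≤ |f x - f y| + |2 * K * (x - y)| := abs_sub _ _
      _ = |f x - f y| + 2 * K * |x - y| := by rw [abs_mul, abs_of_pos (by positivity : 0 < 2 * K)]
      _ ≤ M * r + 2 * K * r := by gcongr; exact hr y hy
      _ = (M + 2 * K) * r := by ring
  have hgcd : g c + 2 * K * (d - c) ≤ g d := by simp only [hgdef]; linarith
  have hpos : 0 < K * (d - c) := mul_pos hK (sub_pos.2 hcd)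
  -- Only the lower half of the guaranteed rise 2K(d - c) is used, so `g d` still exceeds the level
  -- by K(d - c); this serves the radii reaching beyond `d`.
  obtain ⟨s, hs1, hs2⟩ : ∃ s ∈ Icc (g c) (g c + K * (d - c)), s ∉ g '' Z := by
    by_contra! hc
    have h1 := measure_mono_null hc hgZ
    rw [Real.volume_Icc, ENNReal.ofReal_eq_zero] at h1
    linarith
  obtain ⟨x, hx, hxs, hlast⟩ := exists_last_point hg hcd.le (s := s)
    ⟨hs1.1, by linarith [hs1.2]⟩
  refine ⟨x, hx, fun hxZ => hs2 ⟨x, hxZ, hxs⟩, fun r hr hrl => ?_⟩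
  rcases le_or_gt (x + r) d with h | h
  · refine ⟨x + r, by simp [abs_of_pos hr], ?_⟩
    have := hlast (x + r) ⟨by linarith [hx.1], h⟩ (by linarith)
    rw [← hxs] at this
    simp only [hgdef] at this
    rw [abs_sub_comm]
    refine le_trans ?_ (le_abs_self _)
    nlinarith
  · refine ⟨d, by rw [abs_sub_comm, abs_of_nonneg (by linarith [hx.2])]; linarith, ?_⟩
    rw [abs_sub_comm]
    refine le_trans ?_ (le_abs_self _)
    have h1 : g d - g x ≥ K * (d - c) := by rw [hxs]; linarith [hs1.2]
    simp only [hgdef] at h1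
    nlinarith [hx.2]

theorem SteepAt.of_neg {f : ℝ → ℝ} {K ℓ x : ℝ} (h : SteepAt (fun x => -f x) K ℓ x) :
    SteepAt f K ℓ x := fun r hr hrl => by
  obtain ⟨y, hy, hy1⟩ := h r hr hrl
  refine ⟨y, hy, ?_⟩
  rwa [← abs_neg, show -(f x - f y) = -f x - -f y by ring]

theorem littleLip_neg (f : ℝ → ℝ) (x : ℝ) : littleLip (fun x => -f x) x = littleLip f x := by
  have : ∀ y, |-f x - -f y| = |f x - f y| := fun y => by
    rw [← abs_neg]; ring_nf
  simp only [littleLip, oscQuot, this]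

theorem exists_steepAt_of_abs_slope {f : ℝ → ℝ} (hf : Continuous f) {Z : Set ℝ}
    (hZ : volume Z = 0) (hl : ∀ x, littleLip f x ≠ ∞) {c d K : ℝ} (hcd : c < d) (hK : 0 < K)
    (hs : 4 * K * (d - c) ≤ |f d - f c|) : ∃ x ∈ Icc c d, x ∉ Z ∧ SteepAt f K (d - c) x := by
  rcases le_total 0 (f d - f c) with h | h
  · rw [abs_of_nonneg h] at hs
    exact exists_steepAt_of_slope hf hZ hl hcd hK hs
  · rw [abs_of_nonpos h] at hs
    obtain ⟨x, hx, hxZ, hst⟩ := exists_steepAt_of_slope (f := fun x => -f x) hf.neg hZ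
      (fun x => by rw [littleLip_neg]; exact hl x) hcd hK (by linarith)
    exact ⟨x, hx, hxZ, hst.of_neg⟩

theorem exists_steepAt_near {f : ℝ → ℝ} (hf : Continuous f) (hl : ∀ x, littleLip f x ≠ ∞)
    {a b : ℝ} (hZ : volume (Ioo a b \ bigLipInfSet f) = 0) {x K δ : ℝ}
    (hx : x ∈ Ioo a b ∩ bigLipInfSet f) (hK : 0 < K) (hδ : 0 < δ) :
    ∃ x' ∈ Ioo a b ∩ bigLipInfSet f, ∃ ℓ, 0 < ℓ ∧ ℓ ≤ δ ∧ |x' - x| ≤ ℓ ∧ SteepAt f K ℓ x' := by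
  obtain ⟨η, hη, hball⟩ := Metric.isOpen_iff.1 isOpen_Ioo x hx.1
  obtain ⟨n, hn⟩ := exists_nat_gt (max (4 * K) (1 / min δ η))
  have hnK := (le_max_left _ _).trans_lt hn
  have hnd := (le_max_right _ _).trans_lt hn
  have hm : 0 < min δ η := lt_min hδ hη
  obtain ⟨y, hy0, hy1, hy2⟩ := bigLip_eq_top_iff.1 hx.2 n
  have hlt : |x - y| < min δ η := by
    refine hy1.trans ?_
    rw [div_lt_iff₀ (by positivity)]
    rw [div_lt_iff₀ hm] at hnd
    nlinarith
  have hyI : y ∈ Ioo a b := hball (by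
    rw [Metric.mem_ball, Real.dist_eq, abs_sub_comm]
    exact hlt.trans_le (min_le_right _ _))
  have hslope : 4 * K * |x - y| ≤ |f x - f y| := by nlinarith
  obtain ⟨x', hx', hxZ, hst⟩ : ∃ x' ∈ uIcc x y, x' ∉ Ioo a b \ bigLipInfSet f ∧
      SteepAt f K |x - y| x' := by
    rcases lt_or_gt_of_ne (sub_ne_zero.1 (abs_pos.1 hy0)) with h | h
    · rw [uIcc_of_le h.le, abs_sub_comm x y, abs_of_pos (sub_pos.2 h)]
      rw [abs_sub_comm x y, abs_of_pos (sub_pos.2 h), abs_sub_comm (f x)] at hslope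
      exact exists_steepAt_of_abs_slope hf hZ hl h hK hslope
    · rw [uIcc_of_ge h.le, abs_of_pos (sub_pos.2 h)]
      rw [abs_of_pos (sub_pos.2 h)] at hslope
      exact exists_steepAt_of_abs_slope hf hZ hl h hK hslope
  have hxI : x' ∈ Ioo a b := (ordConnected_Ioo.uIcc_subset hx.1 hyI) hx'
  refine ⟨x', ⟨hxI, by_contra fun hc => hxZ ⟨hxI, hc⟩⟩, |x - y|, hy0,
    hlt.le.trans (min_le_left _ _), ?_, hst⟩
  rw [abs_sub_comm x y]
  exact abs_sub_left_of_mem_uIcc hx'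

/-- Points very near to steep points are steep, away from the very small scales. -/
theorem SteepAt.of_near {f : ℝ → ℝ} {K ℓ ℓ' x t r : ℝ} (h : SteepAt f K ℓ x) (hK : 0 ≤ K)
    (ht : |t - x| ≤ 2 * ℓ') (hℓ' : 0 < ℓ') (hℓ : 4 * ℓ' ≤ ℓ) (hr : 4 * ℓ' ≤ r)
    (hrl : r ≤ 4 * ℓ) : ∃ y, |t - y| ≤ r ∧ K / 16 * r ≤ |f t - f y| := by
  -- At scale s/2 the oscillation around `x` is at least K·r/8, so `t` differs by half of that from
  -- `f x` or from `f y`.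
  obtain ⟨s, hs1, hs2, hs3, hs4⟩ : ∃ s, 4 * ℓ' ≤ s ∧ s ≤ ℓ ∧ s ≤ r ∧ r ≤ 4 * s := by
    refine ⟨min r ℓ, le_min hr hℓ, min_le_right _ _, min_le_left _ _, ?_⟩
    rcases le_total r ℓ with h | h
    · rw [min_eq_left h]; linarith
    · rwa [min_eq_right h]
  obtain ⟨y, hy, hy1⟩ := h (s / 2) (by linarith) (by linarith)
  by_cases hc : K / 16 * r ≤ |f t - f x|
  · exact ⟨x, ht.trans (by linarith), hc⟩
  · refine ⟨y, (abs_sub_le t x y).trans (by linarith), ?_⟩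
    have := abs_sub_le (f x) (f t) (f y)
    rw [abs_sub_comm (f x) (f t)] at this
    nlinarith

theorem isTrim_bigLipInfSet {f : ℝ → ℝ} (hf : Continuous f) (hl : ∀ x, littleLip f x ≠ ∞) :
    IsTrim (bigLipInfSet f) := by
  intro a b hab
  by_contra hc
  set E := bigLipInfSet f with hE
  have hEm : MeasurableSet E := (isGδ_bigLipInfSet hf).measurableSet
  have hvol : volume (Ioo a b ∩ E) = volume (Ioo a b) := by
    refine le_antisymm (measure_mono inter_subset_left) ?_
    rw [Real.volume_Ioo, inter_comm]
    exact not_lt.1 hc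
  have hZ : volume (Ioo a b \ E) = 0 := by
    have h1 := measure_inter_add_sdiff (μ := volume) (Ioo a b) hEm
    rw [hvol] at h1
    have hfin : volume (Ioo a b) ≠ ∞ := by simp
    exact (ENNReal.add_right_inj hfin).1 (by rw [h1, add_zero])
  obtain ⟨x₀, hx₀⟩ : (Ioo a b ∩ E).Nonempty := by
    refine nonempty_of_measure_ne_zero (μ := volume) ?_
    rw [hvol, Real.volume_Ioo]
    simpa using hab
  choose! X hX ℓ hℓ0 hℓδ hXℓ hst using
    fun (x : ℝ) (hx : x ∈ Ioo a b ∩ E) (K : ℝ) (hK : 0 < K) (δ : ℝ) (hδ : 0 < δ) =>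
      exists_steepAt_near hf hl hZ hx hK hδ
  -- Pairs (steep point, scale): steepness grows linearly while each scale is at most a quarter of
  -- the previous one, so the limit stays within twice the next scale.
  let S : ℕ → ℝ × ℝ := fun n => Nat.rec (x₀, 1)
    (fun n p => (X p.1 (n + 1) (p.2 / 4), ℓ p.1 (n + 1) (p.2 / 4))) n
  have hS1 : ∀ n, (S (n + 1)).1 = X (S n).1 (n + 1) ((S n).2 / 4) := fun _ => rfl
  have hS2 : ∀ n, (S (n + 1)).2 = ℓ (S n).1 (n + 1) ((S n).2 / 4) := fun _ => rfl
  have hS : ∀ n, (S n).1 ∈ Ioo a b ∩ E ∧ 0 < (S n).2 := by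
    intro n
    induction n with
    | zero => exact ⟨hx₀, one_pos⟩
    | succ n ih =>
      rw [hS1, hS2]
      have := ih.2
      exact ⟨hX _ ih.1 _ (by positivity) _ (by positivity),
        hℓ0 _ ih.1 _ (by positivity) _ (by positivity)⟩
  have hK : ∀ n : ℕ, (0 : ℝ) < n + 1 := fun n => by positivity
  have hpos : ∀ n, 0 < (S n).2 := fun n => (hS n).2
  have hle : ∀ n, (S (n + 1)).2 ≤ (S n).2 / 4 := fun n =>
    hℓδ _ (hS n).1 _ (hK n) _ (by linarith [hpos n])
  have hdist : ∀ n, |(S (n + 1)).1 - (S n).1| ≤ (S (n + 1)).2 := fun n =>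
    hXℓ _ (hS n).1 _ (hK n) _ (by linarith [hpos n])
  have hsteep : ∀ n : ℕ, SteepAt f (n + 1) (S (n + 1)).2 (S (n + 1)).1 := fun n =>
    hst _ (hS n).1 _ (hK n) _ (by linarith [hpos n])
  have hfar : ∀ j k, |(S (k + j)).1 - (S k).1| ≤ 2 * (S (k + 1)).2 := by
    intro j
    induction j with
    | zero => intro k; simp [(hpos (k + 1)).le]
    | succ j ih =>
      intro k
      have h1 := ih (k + 1)
      have h2 := hdist k
      have h3 := hle (k + 1)
      have h4 := hpos (k + 1)
      rw [show k + (j + 1) = k + 1 + j by ring]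
      exact (abs_sub_le _ (S (k + 1)).1 _).trans (by linarith)
  have hgeom : ∀ n, (S n).2 ≤ (1 / 4) ^ n := by
    intro n
    induction n with
    | zero => exact le_of_eq rfl
    | succ n ih => rw [pow_succ]; linarith [hle n]
  have hlim0 : Tendsto (fun n => (S n).2) atTop (𝓝 0) :=
    squeeze_zero (fun n => (hpos n).le) hgeom
      (tendsto_pow_atTop_nhds_zero_of_lt_one (by norm_num) (by norm_num))
  have hcau : CauchySeq fun n => (S n).1 := by
    refine cauchySeq_of_le_geometric (1 / 4) 1 (by norm_num) fun n => ?_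
    rw [dist_comm, Real.dist_eq]
    refine (hdist n).trans ((hgeom (n + 1)).trans ?_)
    rw [pow_succ, one_mul]
    have : (0 : ℝ) < (1 / 4) ^ n := by positivity
    linarith
  obtain ⟨t, ht⟩ := cauchySeq_tendsto_of_complete hcau
  have htk : ∀ k, |t - (S k).1| ≤ 2 * (S (k + 1)).2 := by
    intro k
    refine le_of_tendsto ((ht.sub_const (S k).1).abs) ?_
    filter_upwards [eventually_ge_atTop k] with n hn
    obtain ⟨j, rfl⟩ := Nat.exists_eq_add_of_le hn
    exact hfar j k
  refine hl t (littleLip_eq_top_of_eventually fun k => ?_)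
  have hmem : ∀ᶠ r : ℝ in 𝓝[>] 0, r ∈ Ioo 0 (4 * (S (16 * k + 1)).2) :=
    Ioo_mem_nhdsGT (by linarith [hpos (16 * k + 1)])
  filter_upwards [hmem] with r hr
  have hex : ∃ n, 4 * (S n).2 < r := by
    have := (hlim0.const_mul 4).eventually_lt_const (show 4 * 0 < r by simpa using hr.1)
    exact this.exists
  classical
  -- The radius falls between two consecutive scales. The index exceeds 16k to absorb the factor 16
  -- lost in `SteepAt.of_near`.
  obtain ⟨n, hn⟩ : ∃ n, Nat.find hex = n + 1 + 1 + 16 * k := by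
    have hanti : Antitone fun n => (S n).2 :=
      antitone_nat_of_succ_le fun n => by linarith [hle n, hpos n]
    have h1 : 16 * k + 1 < Nat.find hex := by
      by_contra hc
      have h2 := Nat.find_spec hex
      have h3 := hanti (not_lt.1 hc)
      simp only at h3
      linarith [hr.2]
    exact ⟨Nat.find hex - (16 * k + 2), by omega⟩
  have h1 := Nat.find_spec hex
  have h2 := Nat.find_min hex (m := n + 16 * k + 1) (by omega)
  rw [hn, show n + 1 + 1 + 16 * k = n + 16 * k + 1 + 1 by ring] at h1
  obtain ⟨y, hy, hy1⟩ := (hsteep (n + 16 * k)).of_near (r := r) (by positivity)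
    (htk (n + 16 * k + 1)) (hpos (n + 16 * k + 1 + 1)) (by linarith [hle (n + 16 * k + 1)]) h1.le (not_lt.1 h2)
  refine ⟨y, hy, le_trans ?_ hy1⟩
  have hr0 : 0 < r := hr.1
  gcongr
  push_cast
  linarith [(Nat.cast_nonneg n : (0 : ℝ) ≤ n)]

/-! ### Bumps that are locally constant on a given trim set -/

theorem IsTrim.exists_isCompact {E : Set ℝ} (hE : IsGδ E) (ht : IsTrim E) {a b : ℝ} (hab : a < b) :
    ∃ F : Set ℝ, IsCompact F ∧ F ⊆ Ioo a b ∧ Disjoint F E ∧ 0 < volume F := by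
  have hpos : 0 < volume (Ioo a b \ E) := by
    by_contra hc
    have h1 := measure_inter_add_sdiff (μ := volume) (Ioo a b) hE.measurableSet
    rw [nonpos_iff_eq_zero.1 (not_lt.1 hc), add_zero, inter_comm, Real.volume_Ioo] at h1
    exact (ht a b hab).ne h1
  obtain ⟨F, hF, hFc, hF0⟩ :=
    (measurableSet_Ioo.diff hE.measurableSet).exists_lt_isCompact hpos
  exact ⟨F, hFc, hF.trans sdiff_subset, disjoint_left.2 fun x hx => (hF hx).2, hF0⟩

/-- Compose a tent with the normalised distribution function of Lebesgue measure on `F`: it is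
Lipschitz and locally constant off `F`. Both extreme values must be attained on `F` itself, since
the stage removes exactly these sets. -/
theorem exists_bump {E : Set ℝ} (hE : IsGδ E) (ht : IsTrim E) {a b h : ℝ} (hab : a < b)
    (hh : 0 ≤ h) :
    ∃ (φ : ℝ → ℝ) (F : Set ℝ), IsCompact F ∧ F ⊆ Ioo a b ∧ Disjoint F E ∧
      (∀ y, |φ y| ≤ h) ∧ (∀ y ∉ Ioo a b, φ y = 0) ∧
      (∃ Λ : ℝ, ∀ x y, |φ y - φ x| ≤ Λ * |y - x|) ∧
      (∀ x ∉ F, ∀ᶠ y in 𝓝 x, φ y = φ x) ∧ (∃ y ∈ F, φ y = 0) ∧ ∃ y ∈ F, φ y = h := by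
  obtain ⟨F, hFc, hFab, hFE, hF0⟩ := ht.exists_isCompact hE hab
  have hfin : ∀ s : Set ℝ, volume (F ∩ s) ≠ ∞ := fun s =>
    ((measure_mono inter_subset_left).trans_lt hFc.measure_lt_top).ne
  set v : ℝ → ℝ := fun t => volume.real (F ∩ Iic t) with hv
  set μ := volume.real F with hμdef
  have hμ : 0 < μ := ENNReal.toReal_pos hF0.ne' hFc.measure_lt_top.ne
  have hmono : Monotone v := fun s t hst =>
    measureReal_mono (inter_subset_inter_right _ (Iic_subset_Iic.2 hst)) (hfin _)
  have hstep : ∀ s t, s ≤ t → v t ≤ v s + (t - s) := by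
    intro s t hst
    have h1 : F ∩ Iic t ⊆ (F ∩ Iic s) ∪ Ioc s t := by
      rintro x ⟨hx, hxt⟩
      rcases le_or_gt x s with h | h
      · exact Or.inl ⟨hx, h⟩
      · exact Or.inr ⟨h, hxt⟩
    have h2 : volume ((F ∩ Iic s) ∪ Ioc s t) ≠ ∞ :=
      measure_union_ne_top (hfin _) (by simp)
    refine (measureReal_mono h1 h2).trans ((measureReal_union_le _ _).trans ?_)
    rw [Real.volume_real_Ioc_of_le hst]
  have hlip : ∀ x y, |v y - v x| ≤ |y - x| := by
    intro x y
    rcases le_total x y with h | h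
    · rw [abs_of_nonneg (sub_nonneg.2 (hmono h)), abs_of_nonneg (sub_nonneg.2 h)]
      linarith [hstep x y h]
    · rw [abs_of_nonpos (sub_nonpos.2 (hmono h)), abs_of_nonpos (sub_nonpos.2 h)]
      linarith [hstep y x h]
  have hcont : Continuous v := by
    refine (LipschitzWith.of_dist_le_mul (K := 1) fun x y => ?_).continuous
    simpa [Real.dist_eq] using hlip y x
  have hva : ∀ t ≤ a, v t = 0 := fun t hta => by
    have : F ∩ Iic t = ∅ :=
      eq_empty_of_forall_notMem fun x hx => absurd (hFab hx.1).1 (not_lt.2 (hx.2.trans hta))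
    simp [hv, this]
  have hvb : ∀ t, b ≤ t → v t = μ := fun t hbt => by
    have : F ∩ Iic t = F := inter_eq_left.2 fun x hx => (hFab hx).2.le.trans hbt
    simp [hv, hμdef, this]
  have hv0 : ∀ t, 0 ≤ v t := fun t => measureReal_nonneg
  have hv1 : ∀ t, v t ≤ μ := fun t =>
    measureReal_mono inter_subset_left hFc.measure_lt_top.ne
  have hloc : ∀ x ∉ F, ∀ᶠ y in 𝓝 x, v y = v x := by
    intro x hx
    obtain ⟨δ, hδ, hball⟩ := Metric.isOpen_iff.1 hFc.isClosed.isOpen_compl x hx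
    filter_upwards [Metric.ball_mem_nhds x hδ] with y hy
    simp only [hv]
    congr 1
    ext t
    simp only [mem_inter_iff, mem_Iic, and_congr_right_iff]
    intro htF
    have hnb : t ∉ Metric.ball x δ := fun h => hball h htF
    rw [Real.ball_eq_Ioo, mem_Ioo] at hnb hy
    constructor
    · intro h
      by_contra hc
      exact hnb ⟨by linarith, by linarith⟩
    · intro h
      by_contra hc
      exact hnb ⟨by linarith, by linarith⟩
  have hFne : F.Nonempty := nonempty_of_measure_ne_zero hF0.ne'
  refine ⟨fun t => h * (1 - |2 * (v t / μ) - 1|), F, hFc, hFab, hFE, ?_, ?_, ?_, ?_, ?_, ?_⟩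
  · intro y
    have h0 : 0 ≤ v y / μ := div_nonneg (hv0 y) hμ.le
    have h1 : v y / μ ≤ 1 := (div_le_one hμ).2 (hv1 y)
    have h2 : |2 * (v y / μ) - 1| ≤ 1 := abs_le.2 ⟨by linarith, by linarith⟩
    have h3 := abs_nonneg (2 * (v y / μ) - 1)
    rw [abs_of_nonneg (mul_nonneg hh (by linarith))]
    nlinarith
  · intro y hy
    rcases le_or_gt y a with h1 | h1
    · simp [hva y h1]
    · have : b ≤ y := not_lt.1 fun h2 => hy ⟨h1, h2⟩
      simp only [hvb y this, div_self hμ.ne']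
      norm_num
  · refine ⟨h * (2 / μ), fun x y => ?_⟩
    have h1 : |(|2 * (v x / μ) - 1| - |2 * (v y / μ) - 1|)| ≤ 2 / μ * |y - x| := by
      refine (abs_abs_sub_abs_le_abs_sub _ _).trans ?_
      rw [show 2 * (v x / μ) - 1 - (2 * (v y / μ) - 1) = 2 / μ * (v x - v y) by ring, abs_mul,
        abs_of_pos (by positivity : 0 < 2 / μ), abs_sub_comm (v x)]
      exact mul_le_mul_of_nonneg_left (hlip x y) (by positivity)
    rw [show h * (1 - |2 * (v y / μ) - 1|) - h * (1 - |2 * (v x / μ) - 1|) =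
      h * (|2 * (v x / μ) - 1| - |2 * (v y / μ) - 1|) by ring, abs_mul, abs_of_nonneg hh, mul_assoc]
    gcongr
  · intro x hx
    filter_upwards [hloc x hx] with y hy
    rw [hy]
  · obtain ⟨y, hy, hmin⟩ := hFc.exists_isLeast hFne
    refine ⟨y, hy, ?_⟩
    have hsub : F ∩ Iic y ⊆ {y} := fun x hx => le_antisymm hx.2 (hmin hx.1)
    have : v y = 0 := by
      exact (measureReal_eq_zero_iff (hfin _)).2 (measure_mono_null hsub (by simp))
    simp [this]
  · obtain ⟨t, -, htv⟩ := intermediate_value_Icc hab.le hcont.continuousOn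
      (show μ / 2 ∈ Icc (v a) (v b) by
        rw [hva a le_rfl, hvb b le_rfl]
        exact ⟨by positivity, by linarith⟩)
    -- The half-mass point `t` may miss `F`; the last point of `F` up to `t` has the same `v`.
    have hne : (F ∩ Iic t).Nonempty := by
      by_contra hc
      rw [not_nonempty_iff_eq_empty] at hc
      simp only [hv, hc, measureReal_empty] at htv
      linarith
    obtain ⟨y, hy, hmax⟩ := (hFc.inter_right isClosed_Iic).exists_isGreatest hne
    refine ⟨y, hy.1, ?_⟩
    have hset : F ∩ Iic y = F ∩ Iic t :=
      Subset.antisymm (inter_subset_inter_right _ (Iic_subset_Iic.2 hy.2))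
        fun x hx => ⟨hx.1, hmax hx⟩
    have : v y = μ / 2 := by rw [← htv]; simp only [hv, hset]
    have h2 : 2 * (v y / μ) - 1 = 0 := by rw [this]; field_simp; norm_num
    simp only [h2, abs_zero, sub_zero, mul_one]

/-! ### A Whitney decomposition of open subsets of the line -/

theorem mem_dyadic_iff {n : ℕ} {k : ℤ} {x : ℝ} :
    x ∈ Ico ((k : ℝ) / 2 ^ n) ((k + 1) / 2 ^ n) ↔ ⌊x * 2 ^ n⌋ = k := by
  rw [Int.floor_eq_iff, mem_Ico, div_le_iff₀ (by positivity), lt_div_iff₀ (by positivity)]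

theorem floor_dyadic_le_of_le {m n : ℕ} (hmn : m ≤ n) {x y : ℝ}
    (h : ⌊x * 2 ^ n⌋ ≤ ⌊y * 2 ^ n⌋) : ⌊x * 2 ^ m⌋ ≤ ⌊y * 2 ^ m⌋ := by
  obtain ⟨d, rfl⟩ := Nat.exists_eq_add_of_le hmn
  rw [Int.le_floor]
  set j := ⌊x * 2 ^ m⌋ with hj
  have h1 : (j : ℝ) ≤ x * 2 ^ m := Int.floor_le _
  have h2 : j * 2 ^ d ≤ ⌊x * 2 ^ (m + d)⌋ := by
    rw [Int.le_floor]
    push_cast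
    rw [pow_add, ← mul_assoc]
    gcongr
  have h3 := Int.le_floor.1 (h2.trans h)
  push_cast at h3
  rw [pow_add, ← mul_assoc] at h3
  exact le_of_mul_le_mul_right h3 (by positivity)

theorem floor_dyadic_eq_of_eq {m n : ℕ} (hmn : m ≤ n) {x y : ℝ}
    (h : ⌊x * 2 ^ n⌋ = ⌊y * 2 ^ n⌋) : ⌊x * 2 ^ m⌋ = ⌊y * 2 ^ m⌋ :=
  le_antisymm (floor_dyadic_le_of_le hmn h.le) (floor_dyadic_le_of_le hmn h.ge)

theorem exists_whitney {U : Set ℝ} (hU : IsOpen U) (C : ℝ) :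
    ∃ I : Set (ℝ × ℝ),
      (∀ p ∈ I, p.1 < p.2 ∧ C * (p.2 - p.1) ≤ 1 ∧
        ∀ t ∈ Icc p.1 p.2, ∀ z ∉ U, C * (p.2 - p.1) ≤ |t - z|) ∧
      (∀ p ∈ I, ∀ q ∈ I, ∀ t ∈ Ico p.1 p.2, t ∈ Ico q.1 q.2 → p = q) ∧
      (∀ x ∈ U, ∃ p ∈ I, x ∈ Ico p.1 p.2) ∧
      ∀ x ∈ U, ∃ W ∈ 𝓝 x, {p ∈ I | (Ico p.1 p.2 ∩ W).Nonempty}.Finite := by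
  let cell : ℕ → ℤ → ℝ × ℝ := fun n k => ((k : ℝ) / 2 ^ n, (k + 1) / 2 ^ n)
  let Q : ℕ → ℤ → Prop := fun n k => C / 2 ^ n ≤ 1 ∧
    ∀ t ∈ Icc (cell n k).1 (cell n k).2, ∀ z ∉ U, C / 2 ^ n ≤ |t - z|
  have hlen : ∀ n k, (cell n k).2 - (cell n k).1 = 1 / 2 ^ n := fun n k => by
    simp only [cell]; ring
  have hmem : ∀ {n k x}, x ∈ Ico (cell n k).1 (cell n k).2 ↔ ⌊x * 2 ^ n⌋ = k := mem_dyadic_iff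
  -- The extra 1 pays for moving from `x` to any other point of its cell.
  have hQ : ∀ n x, (C + 1) / 2 ^ n ≤ 1 → (∀ z ∉ U, (C + 1) / 2 ^ n ≤ |x - z|) →
      Q n ⌊x * 2 ^ n⌋ := by
    intro n x h1 hx
    have hp : (0 : ℝ) < 1 / 2 ^ n := by positivity
    rw [add_div] at h1
    refine ⟨by linarith, fun t ht z hz => ?_⟩
    have h2 := hx z hz
    rw [add_div] at h2
    have h3 : |x - t| ≤ 1 / 2 ^ n := by
      have hx' := (hmem (n := n)).2 (rfl : ⌊x * 2 ^ n⌋ = _)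
      have := hlen n ⌊x * 2 ^ n⌋
      rw [abs_le]
      exact ⟨by linarith [hx'.1, ht.2], by linarith [hx'.2, ht.1]⟩
    linarith [abs_sub_le x t z]
  have hN : ∀ δ : ℝ, 0 < δ → ∃ n : ℕ, (C + 1) / 2 ^ n ≤ δ := by
    intro δ hδ
    obtain ⟨n, hn⟩ := pow_unbounded_of_one_lt ((C + 1) / δ) one_lt_two
    refine ⟨n, ?_⟩
    rw [div_le_iff₀ (by positivity)]
    rw [div_lt_iff₀ hδ] at hn
    linarith
  have hball : ∀ x ∈ U, ∃ δ > 0, ∀ y ∈ Metric.ball x δ, ∀ z ∉ U, δ ≤ |y - z| := by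
    intro x hx
    obtain ⟨δ, hδ, hb⟩ := Metric.isOpen_iff.1 hU x hx
    refine ⟨δ / 2, by positivity, fun y hy z hz => ?_⟩
    have h1 : ¬ dist z x < δ := fun h => hz (hb h)
    rw [Metric.mem_ball] at hy
    have h2 := dist_triangle z y x
    rw [← Real.dist_eq, dist_comm]
    linarith
  -- Maximal admissible dyadic cells. Near a point of `U` one fixed level is admissible, so only
  -- coarser or equal cells occur there, giving local finiteness.
  let I : Set (ℝ × ℝ) := {p | ∃ n k, p = cell n k ∧ Q n k ∧
    ∀ m < n, ∀ x ∈ Ico p.1 p.2, ¬ Q m ⌊x * 2 ^ m⌋}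
  refine ⟨I, ?_, ?_, ?_, ?_⟩
  · rintro _ ⟨n, k, rfl, ⟨hq1, hq2⟩, -⟩
    refine ⟨?_, ?_, ?_⟩
    · rw [← sub_pos, hlen]; positivity
    · rw [hlen, mul_one_div]; exact hq1
    · rw [hlen, mul_one_div]; exact hq2
  · rintro _ ⟨n, k, rfl, hq, hmin⟩ _ ⟨m, j, rfl, hq', hmin'⟩ t htn htm
    have hn := hmem.1 htn
    have hm := hmem.1 htm
    rcases lt_trichotomy n m with h | h | h
    · exact absurd (by rwa [hn]) (hmin' n h t htm)
    · subst h
      rw [← hn, ← hm]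
    · exact absurd (by rwa [hm]) (hmin m h t htn)
  · intro x hx
    have hex : ∃ n : ℕ, Q n ⌊x * 2 ^ n⌋ := by
      obtain ⟨δ, hδ, hd⟩ := hball x hx
      obtain ⟨n, hn⟩ := hN (min δ 1) (by positivity)
      exact ⟨n, hQ n x (hn.trans (min_le_right _ _)) fun z hz =>
        (hn.trans (min_le_left _ _)).trans (hd x (Metric.mem_ball_self hδ) z hz)⟩
    classical
    refine ⟨cell (Nat.find hex) ⌊x * 2 ^ Nat.find hex⌋, ⟨_, _, rfl, Nat.find_spec hex, ?_⟩,
      hmem.2 rfl⟩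
    intro m hm y hy
    rw [floor_dyadic_eq_of_eq hm.le (hmem.1 hy)]
    exact Nat.find_min hex hm
  · intro x hx
    obtain ⟨δ, hδ, hd⟩ := hball x hx
    obtain ⟨N, hN⟩ := hN (min δ 1) (by positivity)
    refine ⟨Metric.ball x δ, Metric.ball_mem_nhds x hδ, ?_⟩
    refine Set.Finite.subset ((Set.finite_Iic N).biUnion fun n _ =>
      (Set.finite_Icc ⌊(x - δ) * 2 ^ n⌋ ⌊(x + δ) * 2 ^ n⌋).image (cell n)) ?_
    rintro _ ⟨⟨n, k, rfl, hq, hmin⟩, y, hyp, hyx⟩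
    have hQN : Q N ⌊y * 2 ^ N⌋ := hQ N y (hN.trans (min_le_right _ _)) fun z hz =>
        (hN.trans (min_le_left _ _)).trans (hd y hyx z hz)
    refine mem_iUnion₂.2 ⟨n, ?_, k, ?_, rfl⟩
    · exact not_lt.1 fun h => hmin N h y hyp hQN
    · rw [Real.ball_eq_Ioo] at hyx
      rw [← hmem.1 hyp]
      refine ⟨Int.floor_mono ?_, Int.floor_mono ?_⟩
      · have := hyx.1.le
        gcongr
      · have := hyx.2.le
        gcongr

/-! ### One stage of the construction -/

theorem exists_stage {E : Set ℝ} (hE : IsGδ E) (ht : IsTrim E) {U : Set ℝ} (hU : IsOpen U)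
    (hEU : E ⊆ U) {ε L : ℝ} (hε : 0 < ε) (hL : 0 ≤ L) :
    ∃ (g : ℝ → ℝ) (V : Set ℝ), IsOpen V ∧ E ⊆ V ∧ V ⊆ U ∧ (∀ x, |g x| ≤ ε) ∧
      (∀ x, ∀ z ∉ U, |g x| ≤ ε * |x - z|) ∧
      (∀ x ∈ U, ∃ Λ : ℝ, ∀ᶠ y in 𝓝 x, |g y - g x| ≤ Λ * |y - x|) ∧
      (∀ x ∈ V, ∀ᶠ y in 𝓝 x, g y = g x) ∧
      ∀ x ∈ U, ∃ y ∉ V, |x - y| ≤ ε ∧ uIcc x y ⊆ U ∧ L * |x - y| ≤ |g x - g y| := by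
  -- Bumps get height εC·length = (2L + 1)·length. Hence `g x` is at least L·length away from 0 or
  -- from the top value, while the Whitney bounds keep the height below ε and below ε times the
  -- distance to the complement.
  set C : ℝ := (2 * L + 1) / ε with hCdef
  have hC : 0 < C := by positivity
  have hεC : ε * C = 2 * L + 1 := by rw [hCdef]; field_simp
  obtain ⟨I, hI, hdisj, hcov, hfin⟩ := exists_whitney hU C
  choose! φ F hFc hFI hFE hφ hφ0 hφl hφc hφ1 hφ2 using
    fun (p : ℝ × ℝ) (hp : p ∈ I) => exists_bump hE ht (hI p hp).1
      (show 0 ≤ ε * (C * (p.2 - p.1)) from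
        mul_nonneg hε.le (mul_nonneg hC.le (sub_nonneg.2 (hI p hp).1.le)))
  choose! P hPI hP using hcov
  have hsub : ∀ p ∈ I, Icc p.1 p.2 ⊆ U := by
    intro p hp t htp
    by_contra hc
    have h1 := (hI p hp).2.2 t htp t hc
    rw [sub_self, abs_zero] at h1
    nlinarith [(hI p hp).1]
  classical
  let g : ℝ → ℝ := fun y => if y ∈ U then φ (P y) y else 0
  have hg : ∀ p ∈ I, ∀ y ∈ Ico p.1 p.2, g y = φ p y := by
    intro p hp y hy
    have hyU : y ∈ U := hsub p hp (Ico_subset_Icc_self hy)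
    have : P y = p := hdisj _ (hPI y hyU) _ hp y (hP y hyU) hy
    simp [g, hyU, this]
  let V : Set ℝ := U \ ⋃ p ∈ I, F p
  have hlocal : ∀ x ∈ U, ∃ S : Finset (ℝ × ℝ), (∀ p ∈ S, p ∈ I) ∧
      ∀ᶠ y in 𝓝 x, (g y = ∑ p ∈ S, φ p y) ∧ ∀ p ∈ I, y ∈ F p → p ∈ S := by
    intro x hx
    obtain ⟨W, hW, hWf⟩ := hfin x hx
    refine ⟨hWf.toFinset, fun p hp => ((hWf.mem_toFinset).1 hp).1, ?_⟩
    filter_upwards [hW, hU.mem_nhds hx] with y hyW hyU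
    have hin : ∀ p ∈ I, y ∈ Ico p.1 p.2 → p ∈ hWf.toFinset := fun p hp hy =>
      hWf.mem_toFinset.2 ⟨hp, y, hy, hyW⟩
    refine ⟨?_, fun p hp hy => hin p hp (Ioo_subset_Ico_self (hFI p hp hy))⟩
    rw [hg _ (hPI y hyU) y (hP y hyU), eq_comm]
    refine Finset.sum_eq_single_of_mem _ (hin _ (hPI y hyU) (hP y hyU)) fun p hp hne => ?_
    have hpI := ((hWf.mem_toFinset).1 hp).1
    refine hφ0 p hpI y fun hy => hne ?_
    exact hdisj p hpI _ (hPI y hyU) y (Ioo_subset_Ico_self hy) (hP y hyU)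
  have hVconst : ∀ x ∈ V, ∀ᶠ y in 𝓝 x, g y = g x := by
    rintro x ⟨hxU, hxF⟩
    obtain ⟨S, hS, hev⟩ := hlocal x hxU
    have h1 : ∀ᶠ y in 𝓝 x, ∀ p ∈ S, φ p y = φ p x :=
      (Filter.eventually_all_finset S).2 fun p hp =>
        hφc p (hS p hp) x fun h => hxF (mem_iUnion₂.2 ⟨p, hS p hp, h⟩)
    filter_upwards [hev, h1] with y hy hy1
    rw [hy.1, hev.self_of_nhds.1]
    exact Finset.sum_congr rfl hy1
  have hVopen : IsOpen V := by
    rw [isOpen_iff_mem_nhds]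
    rintro x ⟨hxU, hxF⟩
    obtain ⟨S, hS, hev⟩ := hlocal x hxU
    have h1 : ∀ᶠ y in 𝓝 x, ∀ p ∈ S, y ∉ F p :=
      (Filter.eventually_all_finset S).2 fun p hp =>
        (hFc p (hS p hp)).isClosed.isOpen_compl.mem_nhds
          fun h => hxF (mem_iUnion₂.2 ⟨p, hS p hp, h⟩)
    filter_upwards [hev, h1, hU.mem_nhds hxU] with y hy hy1 hyU
    refine ⟨hyU, fun h => ?_⟩
    obtain ⟨p, hp, hyp⟩ := mem_iUnion₂.1 h
    exact hy1 p (hy.2 p hp hyp) hyp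
  refine ⟨g, V, hVopen, ?_, sdiff_subset, ?_, ?_, ?_, hVconst, ?_⟩
  · refine fun x hx => ⟨hEU hx, fun h => ?_⟩
    obtain ⟨p, hp, hxp⟩ := mem_iUnion₂.1 h
    exact disjoint_left.1 (hFE p hp) hxp hx
  · intro x
    by_cases hx : x ∈ U
    · rw [hg _ (hPI x hx) x (hP x hx)]
      refine (hφ _ (hPI x hx) x).trans ?_
      nlinarith [(hI _ (hPI x hx)).2.1]
    · simp [g, hx, hε.le]
  · intro x z hz
    by_cases hx : x ∈ U
    · rw [hg _ (hPI x hx) x (hP x hx)]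
      refine (hφ _ (hPI x hx) x).trans ?_
      gcongr
      exact (hI _ (hPI x hx)).2.2 x (Ico_subset_Icc_self (hP x hx)) z hz
    · simp only [g, hx, if_false, abs_zero]
      positivity
  · intro x hx
    obtain ⟨S, hS, hev⟩ := hlocal x hx
    choose! Λ hΛ using hφl
    refine ⟨∑ p ∈ S, Λ p, ?_⟩
    filter_upwards [hev] with y hy
    rw [hy.1, hev.self_of_nhds.1, ← Finset.sum_sub_distrib, Finset.sum_mul]
    exact (Finset.abs_sum_le_sum_abs _ _).trans
      (Finset.sum_le_sum fun p hp => hΛ p (hS p hp) x y)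
  · intro x hx
    have hp := hPI x hx
    have hxp := hP x hx
    set p := P x with hpdef
    have hlen : p.2 - p.1 ≤ ε := by
      have h1 := (hI p hp).2.1
      have h2 := (hI p hp).1
      have h3 : ε * (C * (p.2 - p.1)) ≤ ε := by nlinarith
      rw [← mul_assoc, hεC] at h3
      nlinarith
    have hgood : ∀ y ∈ F p, L * (p.2 - p.1) ≤ |g x - g y| →
        y ∉ V ∧ |x - y| ≤ ε ∧ uIcc x y ⊆ U ∧ L * |x - y| ≤ |g x - g y| := by
      intro y hy hLy
      have hyp := hFI p hp hy
      have hxy : |x - y| ≤ p.2 - p.1 := by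
        rw [abs_le]
        exact ⟨by linarith [hxp.1, hyp.2], by linarith [hxp.2, hyp.1]⟩
      refine ⟨fun h => h.2 (mem_iUnion₂.2 ⟨p, hp, hy⟩), hxy.trans hlen, ?_, le_trans ?_ hLy⟩
      · exact (ordConnected_Icc.uIcc_subset (Ico_subset_Icc_self hxp)
          (Ioo_subset_Icc_self hyp)).trans (hsub p hp)
      · gcongr
    obtain ⟨y₀, hy₀, h0⟩ := hφ1 p hp
    obtain ⟨y₁, hy₁, h1⟩ := hφ2 p hp
    have hg0 := (hg p hp y₀ (Ioo_subset_Ico_self (hFI p hp hy₀))).trans h0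
    have hg1 := (hg p hp y₁ (Ioo_subset_Ico_self (hFI p hp hy₁))).trans h1
    by_cases hc : L * (p.2 - p.1) ≤ |g x - g y₀|
    · exact ⟨y₀, hgood y₀ hy₀ hc⟩
    · refine ⟨y₁, hgood y₁ hy₁ ?_⟩
      have h2 := abs_sub_le (g y₁) (g x) (g y₀)
      have h3 := le_abs_self (g y₁ - g y₀)
      rw [hg0, hg1, ← mul_assoc, hεC] at h3
      rw [abs_sub_comm (g y₁) (g x)] at h2
      have h4 := (hI p hp).1
      rw [hg0] at h2 hc
      rw [hg1] at h2 ⊢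
      rw [← mul_assoc, hεC] at h2 ⊢
      linarith

/-! ### Gluing the stages -/

theorem exists_stages {E : Set ℝ} (hE : IsGδ E) (ht : IsTrim E) :
    ∃ (U : ℕ → Set ℝ) (g : ℕ → ℝ → ℝ), (∀ n, IsOpen (U n)) ∧ (∀ n, E ⊆ U n) ∧ Antitone U ∧
      (∀ x ∉ E, ∃ n, x ∉ U n) ∧ (∀ n x, |g n x| ≤ (1 / 2) ^ n) ∧
      (∀ n x, ∀ z ∉ U n, |g n x| ≤ (1 / 2) ^ n * |x - z|) ∧
      (∀ n, ∀ x ∈ U n, ∃ Λ : ℝ, ∀ᶠ y in 𝓝 x, |g n y - g n x| ≤ Λ * |y - x|) ∧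
      (∀ n, ∀ x ∈ U (n + 1), ∀ᶠ y in 𝓝 x, g n y = g n x) ∧
      ∀ n, ∀ x ∈ U n, ∃ y ∉ U (n + 1), |x - y| ≤ (1 / 2) ^ n ∧ uIcc x y ⊆ U n ∧
        n * |x - y| ≤ |g n x - g n y| := by
  obtain ⟨G, hGo, hEG⟩ := isGδ_iff_eq_iInter_nat.1 hE
  choose! g V hVo hEV hVU hg1 hg2 hg3 hg4 hg5 using
    fun (U : Set ℝ) (hU : IsOpen U ∧ E ⊆ U) (n : ℕ) =>
      exists_stage hE ht hU.1 hU.2 (show (0 : ℝ) < (1 / 2) ^ n by positivity)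
        (show (0 : ℝ) ≤ n by positivity)
  -- Intersecting with `G n` forces the open sets to shrink to exactly `E`.
  let U : ℕ → Set ℝ := fun n => Nat.rec univ (fun n W => V W n ∩ G n) n
  have hUs : ∀ n, U (n + 1) = V (U n) n ∩ G n := fun _ => rfl
  have hU : ∀ n, IsOpen (U n) ∧ E ⊆ U n := by
    intro n
    induction n with
    | zero => exact ⟨isOpen_univ, subset_univ _⟩
    | succ n ih =>
      rw [hUs]
      refine ⟨(hVo _ ih n).inter (hGo n), subset_inter (hEV _ ih n) ?_⟩
      rw [hEG]
      exact iInter_subset _ n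
  refine ⟨U, fun n => g (U n) n, fun n => (hU n).1, fun n => (hU n).2,
    antitone_nat_of_succ_le fun n => inter_subset_left.trans (hVU _ (hU n) n), ?_,
    fun n => hg1 _ (hU n) n, fun n => hg2 _ (hU n) n, fun n => hg3 _ (hU n) n,
    fun n x hx => hg4 _ (hU n) n x hx.1, ?_⟩
  · intro x hx
    rw [hEG, mem_iInter, not_forall] at hx
    obtain ⟨n, hn⟩ := hx
    exact ⟨n + 1, fun h => hn h.2⟩
  · intro n x hx
    obtain ⟨y, hy, h⟩ := hg5 _ (hU n) n x hx
    exact ⟨y, fun hyU => hy hyU.1, h⟩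

theorem abs_tsum_sub_tsum_le {g : ℕ → ℝ → ℝ} (hg : ∀ n x, |g n x| ≤ (1 / 2) ^ n) {m : ℕ}
    {x y D : ℝ} (h : ∀ n, m ≤ n → |g n x - g n y| ≤ (1 / 2) ^ n * D) :
    |(∑' n, g n x - ∑' n, g n y) - ∑ n ∈ Finset.range m, (g n x - g n y)| ≤
      2 * (1 / 2) ^ m * D := by
  have hs : ∀ x, Summable fun n => g n x := fun x =>
    Summable.of_norm_bounded summable_geometric_two fun n => hg n x
  rw [← (hs x).tsum_sub (hs y), ← ((hs x).sub (hs y)).sum_add_tsum_nat_add m, add_sub_cancel_left]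
  have h1 : HasSum (fun n : ℕ => (1 / 2 : ℝ) ^ n * ((1 / 2) ^ m * D)) (2 * ((1 / 2) ^ m * D)) :=
    hasSum_geometric_two.mul_right _
  rw [mul_assoc]
  rw [← Real.norm_eq_abs]
  refine tsum_of_norm_bounded h1 fun n => ?_
  rw [← mul_assoc, ← pow_add]
  exact h (n + m) (by omega)

theorem eq_of_uIcc_subset {U : Set ℝ} {g : ℝ → ℝ} (hg : ∀ x ∈ U, ∀ᶠ y in 𝓝 x, g y = g x)
    {x y : ℝ} (h : uIcc x y ⊆ U) : g x = g y := by
  have hloc : IsLocallyConstant ((uIcc x y).domRestrict g) := by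
    rw [IsLocallyConstant.iff_eventually_eq]
    rintro ⟨z, hz⟩
    exact (continuous_subtype_val.tendsto (⟨z, hz⟩ : uIcc x y)).eventually
      (p := fun y => g y = g z) (hg z (h hz))
  have : PreconnectedSpace (uIcc x y) := Subtype.preconnectedSpace isPreconnected_uIcc
  exact hloc.apply_eq_of_preconnectedSpace ⟨x, left_mem_uIcc⟩ ⟨y, right_mem_uIcc⟩

theorem IsTrim.exists_continuous {E : Set ℝ} (ht : IsTrim E) (hE : IsGδ E) :
    ∃ f : ℝ → ℝ, Continuous f ∧ bigLipInfSet f = E ∧ ∀ x ∈ E, littleLip f x = 0 := by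
  obtain ⟨U, g, hUo, hEU, hanti, hUE, hg1, hg2, hg3, hg4, hg5⟩ := exists_stages hE ht
  have hzero : ∀ n, ∀ z ∉ U n, g n z = 0 := fun n z hz => by
    simpa using hg2 n z z hz
  have hlip : ∀ n x, ∃ Λ : ℝ, ∀ᶠ y in 𝓝 x, |g n y - g n x| ≤ Λ * |y - x| := by
    intro n x
    by_cases hx : x ∈ U n
    · exact hg3 n x hx
    · refine ⟨(1 / 2) ^ n, Eventually.of_forall fun y => ?_⟩
      rw [hzero n x hx, sub_zero]
      exact hg2 n y x hx
  have hgc : ∀ n, Continuous (g n) := by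
    intro n
    rw [continuous_iff_continuousAt]
    intro x
    obtain ⟨Λ, hΛ⟩ := hlip n x
    rw [ContinuousAt, tendsto_iff_norm_sub_tendsto_zero]
    refine squeeze_zero' (Eventually.of_forall fun _ => norm_nonneg _) hΛ ?_
    have : Continuous fun y => Λ * |y - x| := by fun_prop
    simpa using this.tendsto x
  have hconst : ∀ n m, n < m → ∀ {x y : ℝ}, uIcc x y ⊆ U m → g n x = g n y :=
    fun n m hnm x y h => eq_of_uIcc_subset (hg4 n) (h.trans (hanti (Nat.succ_le_of_lt hnm)))
  have hsum0 : ∀ m, ∀ {x y : ℝ}, uIcc x y ⊆ U m →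
      ∑ n ∈ Finset.range m, (g n x - g n y) = 0 := fun m x y h =>
    Finset.sum_eq_zero fun n hn => sub_eq_zero.2 (hconst n m (Finset.mem_range.1 hn) h)
  refine ⟨fun x => ∑' n, g n x, continuous_tsum hgc summable_geometric_two hg1, ?_, ?_⟩
  · ext x
    refine ⟨fun hx => ?_, fun hx => ?_⟩
    · by_contra hxE
      obtain ⟨m, hm⟩ := hUE x hxE
      choose Λ hΛ using hlip
      refine bigLip_ne_top_of_eventually (Λ := ∑ n ∈ Finset.range m, Λ n x + 2 * (1 / 2) ^ m) ?_ hx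
      have hev : ∀ᶠ y in 𝓝 x, ∀ n ∈ Finset.range m, |g n y - g n x| ≤ Λ n x * |y - x| :=
        (Filter.eventually_all_finset _).2 fun n _ => hΛ n x
      filter_upwards [hev] with y hy
      have h1 := abs_tsum_sub_tsum_le hg1 (m := m) (x := y) (y := x) (D := |y - x|)
        fun n hn => by
          have hxn : x ∉ U n := fun h => hm (hanti hn h)
          rw [hzero n x hxn, sub_zero]
          exact hg2 n y x hxn
      have h2 : |∑ n ∈ Finset.range m, (g n y - g n x)| ≤
          (∑ n ∈ Finset.range m, Λ n x) * |y - x| := by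
        rw [Finset.sum_mul]
        exact (Finset.abs_sum_le_sum_abs _ _).trans (Finset.sum_le_sum hy)
      rw [abs_le] at h1 h2 ⊢
      constructor <;> nlinarith [h1.1, h1.2, h2.1, h2.2]
    · refine bigLip_eq_top_iff.2 fun k => ?_
      obtain ⟨m, hm⟩ := exists_pow_lt_of_lt_one (show (0 : ℝ) < 1 / (k + 1) by positivity)
        (show (1 / 2 : ℝ) < 1 by norm_num)
      -- Stages after N change the increment by at most 2|x - y|, so the slope N leaves more than k;
      -- m makes `y` close to `x`.
      set N := m + k + 3 with hN
      obtain ⟨y, hy, hxy, hseg, hL⟩ := hg5 N x (hEU N hx)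
      have hpos : 0 < |x - y| := by
        rw [abs_pos, sub_ne_zero]
        rintro rfl
        exact hy (hEU _ hx)
      refine ⟨y, hpos, hxy.trans_lt (lt_of_le_of_lt ?_ hm), ?_⟩
      · exact pow_le_pow_of_le_one (by norm_num) (by norm_num) (by omega)
      · have h1 := abs_tsum_sub_tsum_le hg1 (m := N + 1) (x := x) (y := y) (D := |x - y|)
          fun n hn => by
            have hyn : y ∉ U n := fun h => hy (hanti hn h)
            rw [hzero n y hyn, sub_zero]
            exact hg2 n x y hyn
        rw [Finset.sum_range_succ, hsum0 N hseg, zero_add] at h1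
        have h2 : 2 * (1 / 2 : ℝ) ^ (N + 1) ≤ 2 := by
          have : (1 / 2 : ℝ) ^ (N + 1) ≤ 1 := pow_le_one₀ (by norm_num) (by norm_num)
          linarith
        have h3 := abs_sub_abs_le_abs_sub (g N x - g N y) (∑' n, g n x - ∑' n, g n y)
        rw [abs_sub_comm] at h1
        have h4 : 2 * (1 / 2 : ℝ) ^ (N + 1) * |x - y| ≤ 2 * |x - y| := by gcongr
        have h5 : (N : ℝ) = m + k + 3 := by rw [hN]; push_cast; ring
        rw [h5] at hL
        have h6 : (0 : ℝ) ≤ m * |x - y| := by positivity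
        linarith
  · intro x hx
    refine littleLip_eq_zero_of_frequently fun ε hε => ?_
    rw [frequently_iff]
    intro W hW
    obtain ⟨δ, hδ, hWδ⟩ := mem_nhdsGT_iff_exists_Ioo_subset.1 hW
    have hδ : (0 : ℝ) < δ := hδ
    obtain ⟨m, hm⟩ := exists_pow_lt_of_lt_one (show (0 : ℝ) < min δ (ε / 10) by positivity)
      (show (1 / 2 : ℝ) < 1 by norm_num)
    obtain ⟨y₀, hy₀, hxy₀, -, -⟩ := hg5 m x (hEU m hx)
    -- With `z` a nearest point outside `U (m + 1)`, stages up to m are constant within radius |x -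
    -- z|/2, and later ones are bounded by the distances |x - z| and |y - z| ≤ 3|x - z|/2, whence
    -- the 5 below.
    obtain ⟨z, hz, hzd⟩ := (hUo (m + 1)).isClosed_compl.exists_infDist_eq_dist ⟨y₀, hy₀⟩ x
    have hxz : 0 < |x - z| := by
      rw [abs_pos, sub_ne_zero]
      rintro rfl
      exact hz (hEU _ hx)
    have hxzm : |x - z| ≤ (1 / 2) ^ m := by
      rw [← Real.dist_eq, ← hzd]
      exact (Metric.infDist_le_dist_of_mem hy₀).trans hxy₀
    refine ⟨|x - z| / 2, hWδ ⟨by positivity, ?_⟩, fun y hy => ?_⟩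
    · linarith [hm.trans_le (min_le_left _ _)]
    have hseg : uIcc x y ⊆ U (m + 1) := by
      intro w hw
      by_contra hc
      have h1 := Metric.infDist_le_dist_of_mem (x := x) (show w ∈ (U (m + 1))ᶜ from hc)
      rw [hzd, Real.dist_eq, Real.dist_eq] at h1
      have h2 := abs_sub_left_of_mem_uIcc hw
      rw [abs_sub_comm w, abs_sub_comm y] at h2
      linarith
    have h1 := abs_tsum_sub_tsum_le hg1 (m := m + 1) (x := x) (y := y) (D := 5 * (|x - z| / 2))
      fun n hn => by
        have hzn : z ∉ U n := fun h => hz (hanti hn h)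
        have hgx := hg2 n x z hzn
        have hgy := hg2 n y z hzn
        have hyz : |y - z| ≤ 3 * (|x - z| / 2) := by
          have := abs_sub_le y x z
          rw [abs_sub_comm y x] at this
          linarith
        calc |g n x - g n y| ≤ |g n x| + |g n y| := abs_sub _ _
          _ ≤ (1 / 2) ^ n * |x - z| + (1 / 2) ^ n * (3 * (|x - z| / 2)) :=
            add_le_add hgx (hgy.trans (by gcongr))
          _ = (1 / 2) ^ n * (5 * (|x - z| / 2)) := by ring
    rw [hsum0 (m + 1) hseg, sub_zero] at h1
    refine h1.trans ?_
    have h2 := hm.trans_le (min_le_right _ _)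
    rw [pow_succ, show 2 * ((1 / 2 : ℝ) ^ m * (1 / 2)) * (5 * (|x - z| / 2)) =
      (5 * (1 / 2) ^ m) * (|x - z| / 2) by ring]
    gcongr
    linarith

theorem theorem1 :
    (∀ f : ℝ → ℝ, Continuous f → littleLipInfSet f = ∅ →
      IsGδ (bigLipInfSet f) ∧ IsTrim (bigLipInfSet f)) ∧
    (∀ E : Set ℝ, IsGδ E → IsTrim E →
      ∃ f : ℝ → ℝ, Continuous f ∧ bigLipInfSet f = E ∧ littleLipInfSet f = ∅ ∧
        ∀ x ∈ E, littleLip f x = 0) := by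
  refine ⟨fun f hf hl => ⟨isGδ_bigLipInfSet hf, isTrim_bigLipInfSet hf fun x hx => ?_⟩,
    fun E hE ht => ?_⟩
  · exact eq_empty_iff_forall_notMem.1 hl x hx
  · obtain ⟨f, hf, hfE, hf0⟩ := ht.exists_continuous hE
    refine ⟨f, hf, hfE, eq_empty_of_forall_notMem fun x hx => ?_, hf0⟩
    have hx : littleLip f x = ∞ := hx
    have hxE : x ∈ E := by
      rw [← hfE]
      exact top_le_iff.1 (hx.ge.trans (littleLip_le_bigLip f x))
    rw [hf0 x hxE] at hx
    exact ENNReal.zero_ne_top hx
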